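/- Let $X_1, X_2, \ldots$ be i.i.d. random elements of a metric space $\mathcal{X}$ (with its Borel $\sigma$-algebra) with law $P$, and write $Pf = \int f\,dP$. Let $\mathcal{F}$ be a class of measurable functions $f : \mathcal{X} \to \mathbb{R}$ with $Pf^2 < \infty$ and let $\mathcal{E}$ be a set. For a set $T$, $\ell^\infty(T)$ is the space of bounded real functions on $T$ with the supremum norm, and $\|x\|_T = \sup_{t \in T} |x(t)| \in [0,\infty]$. A $P$-Brownian bridge on $\mathcal{F}$ is a tight Borel random element $G$ of $\ell^\infty(\mathcal{F})$ that is a mean zero Gaussian process with $\operatorname{Cov}(G(f), G(g)) = P(fg) - Pf\,Pg$. A Kiefer--Müller process on $(0,1] \times \mathcal{F}$ is a tight Borel random element $\mathbb{Z}$ of $\ell^\infty((0,1] \times \mathcal{F})$ that is a mean zero Gaussian process with $\operatorname{Cov}(\mathbb{Z}(s,f), \mathbb{Z}(t,g)) = (s \wedge t)\,(P(fg) - Pf\,Pg)$; we write $\mathbb{Z}_s = \mathbb{Z}(s, \cdot) \in \ell^\infty(\mathcal{F})$. Assume: 1. $\mathcal{F}$ is $P$-Donsker, that is, the empirical process $\sqrt{n}(P_n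 - P)$ takes values in $\ell^\infty(\mathcal{F})$ and converges weakly there, in the Hoffmann-Jørgensen sense, to a $P$-Brownian bridge; and $\sup_{x \in \mathcal{X}} \sup_{f \in \mathcal{F}} |f(x) - Pf| < \infty$. 2. The map $f \mapsto Pf$, also denoted by $P$, lies in $\mathbb{D}_\phi \subseteq \ell^\infty(\mathcal{F})$, and $\phi : \mathbb{D}_\phi \to \ell^\infty(\mathcal{E})$ is Hadamard differentiable at $P$ tangentially to a set $\mathbb{D}_0 \subseteq \ell^\infty(\mathcal{F})$ with differential $\dot\phi$. That is, $\dot\phi : \mathbb{D}_0 \to \ell^\infty(\mathcal{E})$ is continuous and linear (meaning $\dot\phi(ax+by) = a\dot\phi(x) + b\dot\phi(y)$ whenever $x, y, ax+by \in \mathbb{D}_0$ and $a, b \in \mathbb{R}$), and $$\lim_{n\to\infty} \frac{\phi(P + t_n h_n) - \phi(P)}{t_n} = \dot\phi(h)$$ for all real $t_n \to 0$ with $t_n \neq 0$ and all $h_n \to h$ with $h \in \mathbb{D}_0$ and $P + t_n h_n \in \mathbb{D}_\phi$ for every $n$. Let $\mathbb{Z}$ be a Kiefer--Müller process on $(0,1]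 \times \mathcal{F}$ whose law on $\ell^\infty((0,1] \times \mathcal{F})$ is concentrated on the set of those $z$ with $z_s \in \mathbb{D}_0$ for all $s \in (0,1]$, and let $G$ be a $P$-Brownian bridge on $\mathcal{F}$, possibly defined on another probability space. Then, for every real $\lambda$, $$\mathbb{P}\bigl( \|\dot\phi \mathbb{Z}_s\|_{(0,1] \times \mathcal{E}} > \lambda \bigr) \leq 2\, \mathbb{P}\bigl( \|\dot\phi G\|_{\mathcal{E}} > \lambda \bigr),$$ where $\|\dot\phi \mathbb{Z}_s\|_{(0,1] \times \mathcal{E}} = \sup_{s \in (0,1],\, e \in \mathcal{E}} |\dot\phi(\mathbb{Z}_s)(e)|$. -/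

import Mathlib

open MeasureTheory ProbabilityTheory Filter Topology
open scoped ENNReal

/-- The Banach space `ℓ^∞(T)` of bounded real functions on `T` with the supremum norm. -/
abbrev LInf (T : Type*) := lp (fun _ : T => ℝ) ∞

/-- `ℓ^∞(T)` carries the Borel sigma-algebra of the supremum norm. -/
noncomputable instance LInf.instMeasurableSpace (T : Type*) : MeasurableSpace (LInf T) := borel (LInf T)

instance LInf.instBorelSpace (T : Type*) : BorelSpace (LInf T) := ⟨rfl⟩

/-- For `z ∈ ℓ^∞(S × T)` and `s ∈ S`, the section `z_s ∈ ℓ^∞(T)`, `t ↦ z (s, t)`. -/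
def LInf.section {S T : Type*} (z : LInf (S × T)) (s : S) : LInf T :=
  ⟨fun t => z (s, t), memℓp_infty ⟨‖z‖, by
    rintro _ ⟨t, rfl⟩
    exact lp.norm_apply_le_norm ENNReal.top_ne_zero z (s, t)⟩⟩

/-- The supremum norm `‖x‖_T = sup_{t ∈ T} |x t| ∈ [0, ∞]` of an arbitrary real function. -/
noncomputable def supNorm {T : Type*} (x : T → ℝ) : ℝ≥0∞ := ⨆ t, ‖x t‖ₑ

/-- The empirical process `√n (P_n - P)(f)` of the first `n` observations. -/
noncomputable def empiricalProcess {𝒳 Ω : Type*} [MeasurableSpace 𝒳] (P : Measure 𝒳)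
    (X : ℕ → Ω → 𝒳) (n : ℕ) (ω : Ω) (f : 𝒳 → ℝ) : ℝ :=
  √(n : ℝ) * ((n : ℝ)⁻¹ * ∑ i ∈ Finset.range n, f (X i ω) - ∫ x, f x ∂P)

/-- The outer expectation `E^* g = inf {E U : U ≥ g, U measurable and integrable}` of a bounded,
possibly non-measurable function `g`. -/
noncomputable def outerExpectation {Ω : Type*} [MeasurableSpace Ω] (μ : Measure Ω)
    (g : Ω → ℝ) : ℝ :=
  sInf {r | ∃ U : Ω → ℝ, Measurable U ∧ Integrable U μ ∧ (∀ ω, g ω ≤ U ω) ∧ r = ∫ ω, U ω ∂μ}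

/-- `Z` is a tight Borel random element of `ℓ^∞(T)` that is a mean zero Gaussian process with
covariance function `c`. In the complete space `ℓ^∞(T)`, almost everywhere strong measurability
means that `Z` agrees almost surely with a Borel measurable map with separable range, that is,
with a Borel measurable map with a tight law. -/
structure IsTightCenteredGaussian {Ω T : Type*} [MeasurableSpace Ω] (μ : Measure Ω)
    (Z : Ω → LInf T) (c : T → T → ℝ) : Prop where
  aestronglyMeasurable : AEStronglyMeasurable Z μ
  isGaussianProcess : IsGaussianProcess (fun (t : T) (ω : Ω) => Z ω t) μ
  mean_zero : ∀ t, ∫ ω, Z ω t ∂μ = 0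
  covariance_eq : ∀ t u, cov[fun ω => Z ω t, fun ω => Z ω u; μ] = c t u

/-- `G` is a (tight) `P`-Brownian bridge on `F`: covariance `P(fg) - Pf Pg`. -/
def IsBrownianBridge {𝒳 Ω : Type*} [MeasurableSpace 𝒳] [MeasurableSpace Ω] (P : Measure 𝒳)
    (F : Set (𝒳 → ℝ)) (μ : Measure Ω) (G : Ω → LInf F) : Prop :=
  IsTightCenteredGaussian μ G fun f g =>
    ∫ x, f.1 x * g.1 x ∂P - (∫ x, f.1 x ∂P) * ∫ x, g.1 x ∂P

/-- `Z` is a (tight) Kiefer-Müller process on `(0,1] × F`: covariance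
`(s ∧ t) (P(fg) - Pf Pg)`. -/
def IsKieferMuller {𝒳 Ω : Type*} [MeasurableSpace 𝒳] [MeasurableSpace Ω] (P : Measure 𝒳)
    (F : Set (𝒳 → ℝ)) (μ : Measure Ω) (Z : Ω → LInf (Set.Ioc (0 : ℝ) 1 × F)) : Prop :=
  IsTightCenteredGaussian μ Z fun a b =>
    min (a.1 : ℝ) (b.1 : ℝ) *
      (∫ x, a.2.1 x * b.2.1 x ∂P - (∫ x, a.2.1 x ∂P) * ∫ x, b.2.1 x ∂P)

/-- The class `F` is Donsker: the empirical process of the observations `X` takes values in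
`ℓ^∞(F)` and converges weakly there, in the sense of Hoffmann-Jørgensen, to a tight
`P`-Brownian bridge (given here through its law `L`). -/
def IsDonsker {𝒳 Ω : Type*} [MeasurableSpace 𝒳] [MeasurableSpace Ω] (P : Measure 𝒳)
    (μ : Measure Ω) (X : ℕ → Ω → 𝒳) (F : Set (𝒳 → ℝ)) : Prop :=
  ∃ G : ℕ → Ω → LInf F, (∀ n ω (f : F), G n ω f = empiricalProcess P X n ω f.1) ∧
    ∃ L : Measure (LInf F), IsProbabilityMeasure L ∧ IsBrownianBridge P F L id ∧
      ∀ h : BoundedContinuousFunction (LInf F) ℝ,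
        Tendsto (fun n => outerExpectation μ fun ω => h (G n ω)) atTop (𝓝 (∫ y, h y ∂L))

/-- `φ : Dφ ⊆ D → E` is Hadamard differentiable at `θ ∈ Dφ` tangentially to the set `D0`, with
differential `dφ : D0 → E`, a continuous map that is linear on `D0` (it respects every linear
combination that stays in `D0`). The values of `φ` off `Dφ` and of `dφ` off `D0` play no role. -/
structure HasHadamardDifferential {D E : Type*} [NormedAddCommGroup D] [NormedSpace ℝ D]
    [NormedAddCommGroup E] [NormedSpace ℝ E]
    (φ : D → E) (Dφ : Set D) (θ : D) (D0 : Set D) (dφ : D → E) : Prop where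
  mem : θ ∈ Dφ
  continuousOn : ContinuousOn dφ D0
  linearOn : ∀ x ∈ D0, ∀ y ∈ D0, ∀ a b : ℝ, a • x + b • y ∈ D0 →
    dφ (a • x + b • y) = a • dφ x + b • dφ y
  tendsto : ∀ (t : ℕ → ℝ) (h : ℕ → D), ∀ h₀ ∈ D0, (∀ n, t n ≠ 0) → Tendsto t atTop (𝓝 0) →
    Tendsto h atTop (𝓝 h₀) → (∀ n, θ + t n • h n ∈ Dφ) →
    Tendsto (fun n => (t n)⁻¹ • (φ (θ + t n • h n) - φ θ)) atTop (𝓝 (dφ h₀))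

/-! This is Lévy's maximal inequality, proved by reflection. Reflecting `z` at time `s` keeps `z` up
to `s` and continues with `2 z_s - z`. It preserves the Kiefer-Müller covariance, hence the law,
since a tight centered Gaussian law on `ℓ^∞` is determined by its covariance
(`IsTightCenteredGaussian.reflect`, `IsTightCenteredGaussian.map_eq`). By linearity `2 dφ(z_s)` is
the sum of `dφ(z_1)` and `dφ` of the reflected path at time one, so if `‖dφ(z_s)‖ > lam`, one of
these two has norm above `lam`. Splitting at the first exceedance in a finite set of times gives the
factor 2 (`LInf.measure_exists_section_mem_le`). Since `Z_1` has the law of `G`, it remains to pass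
to all times: almost every path `s ↦ Z_s` is continuous, by tightness and the uniform variance bound
on `F`.

`D0` need not be measurable or a linear space. Exceedance is therefore encoded by an open set `U`
that agrees with `{‖dφ x‖ > lam}` on `D0`, and `G ∈ D0` almost surely is deduced from tightness
(`ae_map_mem_of_continuous`). -/

/-! ### Coordinates and separable Borel laws on `ℓ^∞(T)`. -/

theorem LInf.abs_apply_le_norm {T : Type*} (z : LInf T) (t : T) : |z t| ≤ ‖z‖ :=
  lp.norm_apply_le_norm ENNReal.top_ne_zero z t

theorem LInf.abs_apply_sub_le_norm {T : Type*} (z w : LInf T) (t : T) :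
    |z t - w t| ≤ ‖z - w‖ :=
  LInf.abs_apply_le_norm (z - w) t

theorem LInf.norm_le {T : Type*} {z : LInf T} {r : ℝ} (hr : 0 ≤ r) (h : ∀ t, |z t| ≤ r) :
    ‖z‖ ≤ r :=
  lp.norm_le_of_forall_le hr h

theorem LInf.continuous_apply {T : Type*} (t : T) : Continuous fun z : LInf T => z t := by
  refine (LipschitzWith.of_dist_le_mul (K := 1) fun z w => ?_).continuous
  simpa [Real.dist_eq, dist_eq_norm] using LInf.abs_apply_sub_le_norm z w t

theorem LInf.measurable_coe (T : Type*) : Measurable fun (z : LInf T) (t : T) => z t :=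
  measurable_pi_lambda _ fun t => (LInf.continuous_apply t).measurable

/-- Countably many coordinates suffice to compute the norms of countably many bounded functions. -/
theorem LInf.exists_countable_norming {T : Type*} {c : Set (LInf T)} (hc : c.Countable) :
    ∃ T₀ : Set T, T₀.Countable ∧
      ∀ x ∈ c, ∀ r : ℝ, 0 ≤ r → (∀ t ∈ T₀, |x t| ≤ r) → ‖x‖ ≤ r := by
  have key : ∀ x : LInf T, ∃ T₀ : Set T, T₀.Countable ∧
      ∀ r : ℝ, 0 ≤ r → (∀ t ∈ T₀, |x t| ≤ r) → ‖x‖ ≤ r := by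
    intro x
    have h : ∀ q : {q : ℚ // 0 ≤ (q : ℝ) ∧ (q : ℝ) < ‖x‖}, ∃ t, (q.1 : ℝ) < |x t| := by
      intro q
      by_contra! h
      exact absurd (LInf.norm_le q.2.1 h) (not_le.2 q.2.2)
    choose τ hτ using h
    refine ⟨Set.range τ, Set.countable_range τ, fun r hr h => ?_⟩
    by_contra! hlt
    obtain ⟨q, hq₁, hq₂⟩ := exists_rat_btwn hlt
    have := hτ ⟨q, hr.trans hq₁.le, hq₂⟩
    linarith [h _ ⟨⟨q, hr.trans hq₁.le, hq₂⟩, rfl⟩]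
  choose τ hτ₁ hτ₂ using key
  exact ⟨⋃ x ∈ c, τ x, hc.biUnion fun x _ => hτ₁ x, fun x hx r hr h =>
    hτ₂ x r hr fun t ht => h t (Set.mem_biUnion hx ht)⟩

/-- On a separable subset of `ℓ^∞(T)` every open set is measurable for the coordinates. -/
theorem LInf.exists_measurableSet_cylinder {T : Type*} {c : Set (LInf T)} (hc : c.Countable)
    {U : Set (LInf T)} (hU : IsOpen U) :
    ∃ E : Set (T → ℝ), MeasurableSet E ∧
      ∀ z ∈ closure c, (z ∈ U ↔ (fun t => z t) ∈ E) := by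
  obtain ⟨T₀, hT₀, hnorm⟩ := LInf.exists_countable_norming (hc.image2 hc (fun x y => x - y))
  have hball : ∀ z ∈ closure c, ∀ x ∈ c, ∀ r : ℝ, 0 ≤ r →
      (∀ t ∈ T₀, |z t - x t| ≤ r) → ‖z - x‖ ≤ r := by
    intro z hz x hx r hr h
    refine le_of_forall_pos_le_add fun δ hδ => ?_
    obtain ⟨y, hy, hzy⟩ := Metric.mem_closure_iff.1 hz (δ / 2) (half_pos hδ)
    rw [dist_eq_norm] at hzy
    have h₁ : ‖y - x‖ ≤ r + δ / 2 := by
      refine hnorm _ (Set.mem_image2_of_mem hy hx) _ (by positivity) fun t ht => ?_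
      have h₂ := LInf.abs_apply_sub_le_norm z y t
      have h₃ := h t ht
      change |y t - x t| ≤ _
      rw [abs_sub_comm] at h₂
      have := abs_sub_le (y t) (z t) (x t)
      linarith
    have := norm_sub_le_norm_sub_add_norm_sub z y x
    linarith
  -- On `closure c`, `U` is the union of the countably many closed balls with center in `c` and
  -- rational radius that it contains; by `hball` the coordinates in `T₀` decide membership in each.
  let J : Set (LInf T × ℚ) :=
    {p | p.1 ∈ c ∧ 0 ≤ (p.2 : ℝ) ∧ Metric.closedBall p.1 (p.2 : ℝ) ⊆ U}
  have hJ : J.Countable :=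
    (hc.prod (Set.countable_univ (α := ℚ))).mono fun _ hp =>
      Set.mem_prod.2 ⟨hp.1, Set.mem_univ _⟩
  refine ⟨⋃ p ∈ J, ⋂ t ∈ T₀, {g : T → ℝ | |g t - p.1 t| ≤ p.2}, ?_, fun z hz => ?_⟩
  · refine .biUnion hJ fun p _ => .biInter hT₀ fun t _ => ?_
    exact measurableSet_le (by fun_prop) measurable_const
  simp only [Set.mem_iUnion, Set.mem_iInter, Set.mem_ofPred_eq, exists_prop]
  constructor
  · intro hzU
    obtain ⟨ε, hε, hεU⟩ := Metric.isOpen_iff.1 hU z hzU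
    obtain ⟨q, hq₀, hq⟩ := exists_rat_btwn (half_pos hε)
    obtain ⟨y, hy, hzy⟩ := Metric.mem_closure_iff.1 hz q hq₀
    refine ⟨(y, q), ⟨hy, hq₀.le, fun w hw => hεU ?_⟩, fun t _ => ?_⟩
    · have := dist_triangle w y z
      rw [Metric.mem_closedBall] at hw
      rw [Metric.mem_ball]
      rw [dist_comm] at hzy
      simp only at hw
      linarith
    · rw [dist_eq_norm] at hzy
      exact (LInf.abs_apply_sub_le_norm z y t).trans hzy.le
  · rintro ⟨p, ⟨hpc, hp₀, hpU⟩, h⟩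
    apply hpU
    rw [Metric.mem_closedBall, dist_eq_norm]
    exact hball z hz p.1 hpc p.2 hp₀ h

/-- Finite Borel measures on `ℓ^∞(T)` that live on a separable set are determined by the law of
the coordinates. -/
theorem LInf.measure_ext {T : Type*} {μ ν : Measure (LInf T)} [IsFiniteMeasure μ]
    {S S' : Set (LInf T)} (hS : TopologicalSpace.IsSeparable S)
    (hS' : TopologicalSpace.IsSeparable S') (hμ : ∀ᵐ z ∂μ, z ∈ S) (hν : ∀ᵐ z ∂ν, z ∈ S')
    (h : μ.map (fun z t => z t) = ν.map (fun z t => z t)) : μ = ν := by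
  obtain ⟨c, hc, hSc⟩ := hS.union hS'
  have hopen : ∀ U : Set (LInf T), IsOpen U → μ U = ν U := by
    intro U hU
    obtain ⟨E, hE, hUE⟩ := LInf.exists_measurableSet_cylinder hc hU
    have h₁ : μ U = μ ((fun z t => z t) ⁻¹' E) := measure_congr <| by
      filter_upwards [hμ] with z hz
      exact propext (hUE z (hSc (.inl hz)))
    have h₂ : ν U = ν ((fun z t => z t) ⁻¹' E) := measure_congr <| by
      filter_upwards [hν] with z hz
      exact propext (hUE z (hSc (.inr hz)))
    rw [h₁, h₂, ← Measure.map_apply (LInf.measurable_coe T) hE,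
      ← Measure.map_apply (LInf.measurable_coe T) hE, h]
  exact ext_of_generate_finite _ (BorelSpace.measurable_eq (α := LInf T)) isPiSystem_isOpen
    (fun U hU => hopen U hU) (hopen _ isOpen_univ)

/-! ### Tight Gaussian processes: uniqueness in law and path regularity. -/

/-- Centered Gaussian processes with the same covariance have the same law on the product space. -/
theorem map_eq_of_isGaussianProcess {Ω Ω' T : Type*} [MeasurableSpace Ω] [MeasurableSpace Ω']
    {μ : Measure Ω} {μ' : Measure Ω'} {X : T → Ω → ℝ} {Y : T → Ω' → ℝ}
    (hX : IsGaussianProcess X μ) (hY : IsGaussianProcess Y μ')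
    (hX_meas : AEMeasurable (fun ω t => X t ω) μ) (hY_meas : AEMeasurable (fun ω t => Y t ω) μ')
    (hX₀ : ∀ t, ∫ ω, X t ω ∂μ = 0) (hY₀ : ∀ t, ∫ ω, Y t ω ∂μ' = 0)
    (hcov : ∀ t u, cov[X t, X u; μ] = cov[Y t, Y u; μ']) :
    μ.map (fun ω t => X t ω) = μ'.map (fun ω t => Y t ω) := by
  have := hX.isProbabilityMeasure
  have := hY.isProbabilityMeasure
  have hX2 t : MemLp (X t) 2 μ := (hX.hasGaussianLaw_eval t).memLp_two
  have hY2 t : MemLp (Y t) 2 μ' := (hY.hasGaussianLaw_eval t).memLp_two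
  have hfdd (I : Finset T) :
      μ.map (fun ω => I.restrict (X · ω)) = μ'.map (fun ω => I.restrict (Y · ω)) := by
    classical
    have hXI := hX.hasGaussianLaw I
    have hYI := hY.hasGaussianLaw I
    have := hXI.isGaussian_map
    have := hYI.isGaussian_map
    -- The characteristic function of a Gaussian law at `L` depends only on the mean and variance of
    -- `L`; in coordinates these reduce to means and covariances.
    refine Measure.ext_of_charFunDual (funext fun L => ?_)
    obtain ⟨a, hL⟩ : ∃ a : I → ℝ, ∀ x : I → ℝ, L x = ∑ i, a i * x i := by
      refine ⟨fun i => L (Pi.single i 1), fun x => ?_⟩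
      conv_lhs => rw [← Finset.univ_sum_single x, map_sum]
      refine Finset.sum_congr rfl fun i _ => ?_
      have : Pi.single i (x i) = x i • (Pi.single i (1 : ℝ) : I → ℝ) := by
        rw [← Pi.single_smul]; simp
      rw [this, map_smul, smul_eq_mul, mul_comm]
    have hmean₁ : ∫ ω, L (I.restrict (X · ω)) ∂μ = 0 := by
      simp_rw [hL, Finset.restrict]
      rw [integral_finsetSum _ fun (i : I) _ => ((hX2 i).integrable one_le_two).const_mul _]
      simp [integral_const_mul, hX₀]
    have hmean₂ : ∫ ω, L (I.restrict (Y · ω)) ∂μ' = 0 := by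
      simp_rw [hL, Finset.restrict]
      rw [integral_finsetSum _ fun (i : I) _ => ((hY2 i).integrable one_le_two).const_mul _]
      simp [integral_const_mul, hY₀]
    have hvar : Var[fun ω => L (I.restrict (X · ω)); μ] =
        Var[fun ω => L (I.restrict (Y · ω)); μ'] := by
      rw [← covariance_self (hXI.map_fun L).aemeasurable,
        ← covariance_self (hYI.map_fun L).aemeasurable]
      simp_rw [hL, Finset.restrict]
      rw [covariance_fun_sum_fun_sum (fun i : I => (hX2 i).const_mul _)
          fun i : I => (hX2 i).const_mul _,
        covariance_fun_sum_fun_sum (fun i : I => (hY2 i).const_mul _)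
          fun i : I => (hY2 i).const_mul _]
      simp only [covariance_const_mul_left, covariance_const_mul_right]
      simp_rw [hcov]
    rw [hXI.charFunDual_map_eq_fun, hYI.charFunDual_map_eq_fun, hmean₁, hmean₂, hvar]
  have hlim := isProjectiveLimit_map hX_meas
  simp_rw [hfdd] at hlim
  exact hlim.unique (isProjectiveLimit_map hY_meas)

/-- Almost every value of an almost everywhere strongly measurable map is charged. -/
theorem MeasureTheory.AEStronglyMeasurable.ae_measure_ball_pos {Ω E : Type*}
    [MeasurableSpace Ω] {μ : Measure Ω}
    [PseudoMetricSpace E] {Y : Ω → E} (hY : AEStronglyMeasurable Y μ) :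
    ∀ᵐ ω ∂μ, ∀ ε > 0, 0 < μ {ω' | dist (Y ω') (Y ω) < ε} := by
  obtain ⟨S, ⟨c, hc, hSc⟩, hYS⟩ := hY.isSeparable_ae_range
  -- Only countably many balls have center in `c` and rational radius, so those that are not charged
  -- can be avoided simultaneously.
  have h : ∀ᵐ ω ∂μ, ∀ y ∈ c, ∀ q : ℚ, dist (Y ω) y < q → 0 < μ {ω' | dist (Y ω') y < q} := by
    refine (ae_ball_iff hc).2 fun y _ => ae_all_iff.2 fun q => ?_
    rcases eq_or_ne (μ {ω' | dist (Y ω') y < q}) 0 with h₀ | h₀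
    · have : ∀ᵐ ω ∂μ, ¬ dist (Y ω) y < q := by rw [ae_iff]; simpa using h₀
      exact this.mono fun ω h₁ h₂ => absurd h₂ h₁
    · exact .of_forall fun _ _ => pos_iff_ne_zero.2 h₀
  filter_upwards [h, hYS] with ω hω hωS ε hε
  obtain ⟨q, hq₀, hq⟩ := exists_rat_btwn (half_pos hε)
  obtain ⟨y, hy, hωy⟩ := Metric.mem_closure_iff.1 (hSc hωS) q hq₀
  refine (hω y hy q hωy).trans_le (measure_mono fun ω' hω' => ?_)
  have := dist_triangle_right (Y ω') (Y ω) y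
  simp only [Set.mem_ofPred_eq] at hω' ⊢
  linarith

namespace IsTightCenteredGaussian

variable {Ω Ω' T : Type*} [MeasurableSpace Ω] [MeasurableSpace Ω'] {μ : Measure Ω}
  {μ' : Measure Ω'} {Z : Ω → LInf T} {Z' : Ω' → LInf T} {k : T → T → ℝ}

theorem memLp_two (hZ : IsTightCenteredGaussian μ Z k) (t : T) : MemLp (fun ω => Z ω t) 2 μ :=
  (hZ.isGaussianProcess.hasGaussianLaw_eval t).memLp_two

theorem integrable (hZ : IsTightCenteredGaussian μ Z k) (t : T) : Integrable (fun ω => Z ω t) μ :=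
  (hZ.isGaussianProcess.hasGaussianLaw_eval t).integrable

/-- The law of a tight centered Gaussian process is determined by its covariance function. -/
theorem map_eq (hZ : IsTightCenteredGaussian μ Z k) (hZ' : IsTightCenteredGaussian μ' Z' k) :
    μ.map Z = μ'.map Z' := by
  have := hZ.isGaussianProcess.isProbabilityMeasure
  have hm := hZ.aestronglyMeasurable.aemeasurable
  have hm' := hZ'.aestronglyMeasurable.aemeasurable
  obtain ⟨S, hS, hZS⟩ := hZ.aestronglyMeasurable.isSeparable_ae_range
  obtain ⟨S', hS', hZS'⟩ := hZ'.aestronglyMeasurable.isSeparable_ae_range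
  have hcoe := LInf.measurable_coe T
  refine LInf.measure_ext hS.closure hS'.closure ?_ ?_ ?_
  · exact (ae_map_iff hm (p := (· ∈ closure S)) isClosed_closure.measurableSet).2 <|
      hZS.mono fun ω h => subset_closure h
  · exact (ae_map_iff hm' (p := (· ∈ closure S')) isClosed_closure.measurableSet).2 <|
      hZS'.mono fun ω h => subset_closure h
  · rw [AEMeasurable.map_map_of_aemeasurable hcoe.aemeasurable hm,
      AEMeasurable.map_map_of_aemeasurable hcoe.aemeasurable hm']
    exact map_eq_of_isGaussianProcess hZ.isGaussianProcess hZ'.isGaussianProcess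
      (hcoe.comp_aemeasurable hm) (hcoe.comp_aemeasurable hm') hZ.mean_zero hZ'.mean_zero
      fun t u => (hZ.covariance_eq t u).trans (hZ'.covariance_eq t u).symm

/-- Almost every path of a tight centered process is uniformly continuous for the `L²`-semimetric
of the process. -/
theorem ae_uniformly_continuous (hZ : IsTightCenteredGaussian μ Z k) :
    ∀ᵐ ω ∂μ, ∀ ε > 0, ∃ δ > 0, ∀ t u, k t t - 2 * k t u + k u u < δ → |Z ω t - Z ω u| ≤ ε := by
  have := hZ.isGaussianProcess.isProbabilityMeasure
  filter_upwards [hZ.aestronglyMeasurable.ae_measure_ball_pos] with ω hω ε hε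
  have hε3 : 0 < ε / 3 := by positivity
  set p := μ {ω' | dist (Z ω') (Z ω) < ε / 3} with hp
  have hp₀ : 0 < p := hω _ hε3
  have hp_top : p ≠ ∞ := measure_ne_top _ _
  -- If the path `Z ω` varies by more than `ε` between `t` and `u`, every path within `ε / 3` of it
  -- varies by at least `ε / 3`. Chebyshev then gives `p ≤ Var / (ε / 3) ^ 2`, which this `δ`
  -- excludes.
  refine ⟨p.toReal * (ε / 3) ^ 2, mul_pos (ENNReal.toReal_pos hp₀.ne' hp_top) (by positivity),
    fun t u htu => ?_⟩
  by_contra! hlt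
  have hmem : MemLp (fun ω => Z ω t - Z ω u) 2 μ := (hZ.memLp_two t).sub (hZ.memLp_two u)
  have hmean : ∫ ω, (Z ω t - Z ω u) ∂μ = 0 := by
    rw [integral_sub (hZ.integrable t) (hZ.integrable u), hZ.mean_zero, hZ.mean_zero, sub_zero]
  have hvar : Var[fun ω => Z ω t - Z ω u; μ] = k t t - 2 * k t u + k u u := by
    rw [variance_fun_sub (hZ.memLp_two t) (hZ.memLp_two u), ← covariance_self, ← covariance_self,
      hZ.covariance_eq, hZ.covariance_eq, hZ.covariance_eq]
    · exact (hZ.memLp_two u).aemeasurable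
    · exact (hZ.memLp_two t).aemeasurable
  have hcheb := meas_ge_le_variance_div_sq hmem hε3
  rw [hmean, hvar] at hcheb
  have hsub : {ω' | dist (Z ω') (Z ω) < ε / 3} ⊆ {ω' | ε / 3 ≤ |Z ω' t - Z ω' u - 0|} := by
    intro ω' hω'
    simp only [Set.mem_ofPred_eq, dist_eq_norm, sub_zero] at hω' ⊢
    have h₁ := LInf.abs_apply_sub_le_norm (Z ω') (Z ω) t
    have h₂ := LInf.abs_apply_sub_le_norm (Z ω') (Z ω) u
    by_contra! h₃
    rw [abs_le] at h₁ h₂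
    rw [abs_lt] at h₃
    rcases lt_abs.1 hlt with h | h <;> linarith
  have hle := ENNReal.toReal_mono ENNReal.ofReal_ne_top ((measure_mono hsub).trans hcheb)
  rw [← hp] at hle
  have hpr := ENNReal.toReal_pos hp₀.ne' hp_top
  have hpos : 0 < (k t t - 2 * k t u + k u u) / (ε / 3) ^ 2 := by
    by_contra! h
    rw [ENNReal.ofReal_of_nonpos h, ENNReal.toReal_zero] at hle
    linarith
  rw [ENNReal.toReal_ofReal hpos.le, le_div_iff₀ (by positivity)] at hle
  linarith

end IsTightCenteredGaussian

/-! ### Pushing concentration on a possibly non-measurable set through a continuous map. -/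

/-- If `f` takes values in `D` almost everywhere, then the law of `f` is concentrated on `D`, even
if `D` is not measurable, provided that the measure is tight. -/
theorem MeasureTheory.ae_map_mem_of_continuous {E E' : Type*} [PseudoMetricSpace E]
    [CompleteSpace E] [MeasurableSpace E] [BorelSpace E] [TopologicalSpace E'] [T2Space E']
    [MeasurableSpace E'] [BorelSpace E'] {ν : Measure E} [IsFiniteMeasure ν] {S : Set E}
    (hS : TopologicalSpace.IsSeparable S) (hνS : ∀ᵐ z ∂ν, z ∈ S) {f : E → E'} (hf : Continuous f)
    {D : Set E'} (hD : ∀ᵐ z ∂ν, f z ∈ D) : ∀ᵐ x ∂(ν.map f), x ∈ D := by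
  let H := closure S
  have hH : MeasurableSet H := isClosed_closure.measurableSet
  have : CompleteSpace H := isClosed_closure.completeSpace_coe
  have : SecondCountableTopology H := hS.closure.secondCountableTopology
  have hHν : ∀ᵐ z ∂ν, z ∈ H := hνS.mono fun _ h => subset_closure h
  obtain ⟨N, hDN, hN, hνN⟩ := exists_measurable_superset_of_null (mem_ae_iff.1 (hD.and hHν))
  have hMH : Nᶜ ⊆ H := fun z hz => by
    by_contra h
    exact hz (hDN fun h' => h h'.2)
  let P := ν.comap ((↑) : H → E)
  have hP (A : Set H) : P A = ν ((↑) '' A) := comap_subtype_coe_apply hH ν A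
  have : IsFiniteMeasure P := ⟨by rw [hP]; exact measure_lt_top _ _⟩
  have hM : MeasurableSet (((↑) : H → E) ⁻¹' Nᶜ) := measurable_subtype_coe hN.compl
  have hPM : P (((↑) : H → E) ⁻¹' Nᶜ) = ν Set.univ := by
    rw [hP, Subtype.image_preimage_coe, Set.inter_eq_right.2 hMH, measure_compl hN (by simp [hνN]),
      hνN, tsub_zero]
  refine mem_ae_iff.2 (nonpos_iff_eq_zero.1 (le_of_forall_pos_le_add fun ε hε => ?_))
  rw [zero_add]
  rcases eq_or_ne (ν Set.univ) 0 with h₀ | h₀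
  · have : ν = 0 := Measure.measure_univ_eq_zero.1 h₀
    simp [this]
  -- Inner regularity on the complete separable space `H` gives a compact `K` off the null set `N`
  -- that misses mass at most `ε`. Its image is compact, hence measurable, and lies in `D`.
  obtain ⟨K, hKM, ⟨hK, -⟩, hKε⟩ := innerRegular_isCompact_isClosed_measurableSet_of_finite P hM
    (ν Set.univ - ε) (by
      rw [hPM]
      exact ENNReal.sub_lt_self (measure_ne_top _ _) h₀ hε.ne')
  have hK' : IsCompact (((↑) : H → E) '' K) := hK.image continuous_subtype_val
  have hfK : IsCompact (f '' (((↑) : H → E) '' K)) := hK'.image hf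
  have hfKD : f '' (((↑) : H → E) '' K) ⊆ D := by
    rintro _ ⟨_, ⟨x, hx, rfl⟩, rfl⟩
    by_contra h
    exact hKM hx (hDN fun h' => h h'.1)
  have hle : ν (((↑) : H → E) '' K) ≤ ν (f ⁻¹' (f '' (((↑) : H → E) '' K))) :=
    measure_mono (Set.subset_preimage_image _ _)
  have hpre := hf.measurable hfK.measurableSet
  calc (ν.map f) Dᶜ ≤ (ν.map f) (f '' (((↑) : H → E) '' K))ᶜ :=
        measure_mono (Set.compl_subset_compl.2 hfKD)
    _ = ν Set.univ - ν (f ⁻¹' (f '' (((↑) : H → E) '' K))) := by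
        rw [Measure.map_apply hf.measurable hfK.measurableSet.compl, Set.preimage_compl,
          measure_compl hpre (measure_ne_top _ _)]
    _ ≤ ε := by
        rw [hP] at hKε
        rw [tsub_le_iff_left]
        have := tsub_le_iff_right.1 hKε.le
        exact this.trans (add_le_add_left hle ε)

/-! ### Sections, reflection and Lévy's inequality. -/

theorem LInf.continuous_section {S T : Type*} (s : S) :
    Continuous fun z : LInf (S × T) => LInf.section z s := by
  refine (LipschitzWith.of_dist_le_mul (K := 1) fun z w => ?_).continuous
  rw [NNReal.coe_one, one_mul, dist_eq_norm, dist_eq_norm]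
  exact LInf.norm_le (norm_nonneg _) fun t => LInf.abs_apply_sub_le_norm z w (s, t)

open Classical in
/-- The path that follows `z` up to `s` and then the reflection of `z` at its value at `s`. -/
noncomputable def LInf.reflect {S T : Type*} [LinearOrder S] (s : S) (z : LInf (S × T)) :
    LInf (S × T) :=
  ⟨fun p => if p.1 ≤ s then z p else 2 * z (s, p.2) - z p, memℓp_infty ⟨3 * ‖z‖, by
    rintro _ ⟨p, rfl⟩
    have h₁ := LInf.abs_apply_le_norm z p
    have h₂ := LInf.abs_apply_le_norm z (s, p.2)
    dsimp only
    rw [Real.norm_eq_abs]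
    rw [abs_le] at *
    split_ifs <;> constructor <;> linarith⟩⟩

section Reflect

variable {S T : Type*} [LinearOrder S]

open Classical in
theorem LInf.reflect_apply (s : S) (z : LInf (S × T)) (p : S × T) :
    LInf.reflect s z p = if p.1 ≤ s then z p else 2 * z (s, p.2) - z p := rfl

theorem LInf.reflect_apply_of_le {s : S} (z : LInf (S × T)) {p : S × T} (h : p.1 ≤ s) :
    LInf.reflect s z p = z p := by
  rw [LInf.reflect_apply, if_pos h]

theorem LInf.reflect_apply_of_lt {s : S} (z : LInf (S × T)) {p : S × T} (h : s < p.1) :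
    LInf.reflect s z p = 2 * z (s, p.2) - z p := by
  rw [LInf.reflect_apply, if_neg h.not_ge]

theorem LInf.section_reflect_of_le {r s : S} (z : LInf (S × T)) (h : r ≤ s) :
    LInf.section (LInf.reflect s z) r = LInf.section z r :=
  lp.ext <| funext fun t => LInf.reflect_apply_of_le z (p := (r, t)) h

/-- The form `a • x + b • y` is the one that `HasHadamardDifferential.linearOn` accepts; at `r = s`
both branches of the reflection agree. -/
theorem LInf.section_reflect_of_ge {r s : S} (z : LInf (S × T)) (h : s ≤ r) :
    LInf.section (LInf.reflect s z) r =
      (2 : ℝ) • LInf.section z s + (-1 : ℝ) • LInf.section z r := by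
  refine lp.ext <| funext fun t => ?_
  change LInf.reflect s z (r, t) = 2 * z (s, t) + -1 * z (r, t)
  rcases h.eq_or_lt with rfl | h
  · exact (LInf.reflect_apply_of_le z (p := (s, t)) le_rfl).trans (by ring)
  · exact (LInf.reflect_apply_of_lt z (p := (r, t)) h).trans (by ring)

theorem LInf.continuous_reflect (s : S) :
    Continuous (LInf.reflect s : LInf (S × T) → LInf (S × T)) := by
  refine (LipschitzWith.of_dist_le_mul (K := 3) fun z w => ?_).continuous
  rw [dist_eq_norm, dist_eq_norm]
  refine LInf.norm_le (by positivity) fun p => ?_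
  have h₁ := LInf.abs_apply_sub_le_norm z w p
  have h₂ := LInf.abs_apply_sub_le_norm z w (s, p.2)
  change |LInf.reflect s z p - LInf.reflect s w p| ≤ _
  rw [LInf.reflect_apply, LInf.reflect_apply, NNReal.coe_ofNat]
  rw [abs_le] at *
  split_ifs <;> constructor <;> linarith

/-- Reflection preserves a Kiefer-Müller type covariance structure. -/
theorem IsTightCenteredGaussian.reflect {Ω : Type*} [MeasurableSpace Ω] {μ : Measure Ω}
    {Z : Ω → LInf (S × T)} {a : S → ℝ} (ha : Monotone a) {κ : T → T → ℝ}
    (hZ : IsTightCenteredGaussian μ Z fun p q => min (a p.1) (a q.1) * κ p.2 q.2) (s : S) :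
    IsTightCenteredGaussian μ (fun ω => LInf.reflect s (Z ω))
      fun p q => min (a p.1) (a q.1) * κ p.2 q.2 := by
  classical
  have := hZ.isGaussianProcess.isProbabilityMeasure
  have h2 := hZ.memLp_two
  refine ⟨(LInf.continuous_reflect s).comp_aestronglyMeasurable hZ.aestronglyMeasurable,
    ?_, fun p => ?_, fun p q => ?_⟩
  · refine hZ.isGaussianProcess.of_isGaussianProcess fun p => ⟨{p, (s, p.2)}, ?_⟩
    by_cases hp : p.1 ≤ s
    · exact ⟨.proj ⟨p, by simp⟩, fun ω => LInf.reflect_apply_of_le _ hp⟩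
    · refine ⟨(2 : ℝ) • .proj ⟨(s, p.2), by simp⟩ - .proj ⟨p, by simp⟩, fun ω => ?_⟩
      exact LInf.reflect_apply_of_lt _ (not_le.1 hp)
  · rcases le_or_gt p.1 s with hp | hp
    · simp_rw [LInf.reflect_apply_of_le _ hp]
      exact hZ.mean_zero p
    · simp_rw [LInf.reflect_apply_of_lt _ hp]
      rw [integral_sub ((hZ.integrable _).const_mul 2) (hZ.integrable p), integral_const_mul,
        hZ.mean_zero, hZ.mean_zero]
      simp
  -- If only one time exceeds `s`, both minima equal `a` at the other time, and `2 - 1 = 1`. If both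
  -- exceed `s`, the `a s` terms cancel as `4 - 2 - 2 = 0`.
  · rcases le_or_gt p.1 s with hp | hp <;> rcases le_or_gt q.1 s with hq | hq
    · simp_rw [LInf.reflect_apply_of_le _ hp, LInf.reflect_apply_of_le _ hq]
      exact hZ.covariance_eq p q
    · simp_rw [LInf.reflect_apply_of_le _ hp, LInf.reflect_apply_of_lt _ hq]
      rw [covariance_fun_sub_right (h2 _) ((h2 _).const_mul 2) (h2 _),
        covariance_const_mul_right, hZ.covariance_eq, hZ.covariance_eq,
        min_eq_left (ha hp), min_eq_left (ha (hp.trans hq.le))]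
      ring
    · simp_rw [LInf.reflect_apply_of_lt _ hp, LInf.reflect_apply_of_le _ hq]
      rw [covariance_fun_sub_left ((h2 _).const_mul 2) (h2 _) (h2 _),
        covariance_const_mul_left, hZ.covariance_eq, hZ.covariance_eq,
        min_eq_right (ha hq), min_eq_right (ha (hq.trans hp.le))]
      ring
    · simp_rw [LInf.reflect_apply_of_lt _ hp, LInf.reflect_apply_of_lt _ hq]
      have h₃ : MemLp (fun ω => 2 * Z ω (s, q.2) - Z ω q) 2 μ := ((h2 _).const_mul 2).sub (h2 _)
      rw [covariance_fun_sub_left ((h2 _).const_mul 2) (h2 _) h₃,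
        covariance_fun_sub_right ((h2 _).const_mul 2) ((h2 _).const_mul 2) (h2 _),
        covariance_fun_sub_right (h2 _) ((h2 _).const_mul 2) (h2 _),
        covariance_const_mul_left, covariance_const_mul_right, covariance_const_mul_left,
        covariance_const_mul_right, hZ.covariance_eq, hZ.covariance_eq, hZ.covariance_eq,
        hZ.covariance_eq]
      simp only [min_self, min_eq_left (ha hq.le), min_eq_right (ha hp.le)]
      ring

/-- Lévy's maximal inequality for a law on paths that is invariant under reflections. -/
theorem LInf.measure_exists_section_mem_le {ν : Measure (LInf (S × T))}
    (hν : ∀ s, ν.map (LInf.reflect s) = ν) {U : Set (LInf T)} (hU : IsOpen U) (m : S)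
    (hm : ∀ s, ∀ᵐ z ∂ν, LInf.section z s ∈ U →
      LInf.section z m ∈ U ∨ LInf.section (LInf.reflect s z) m ∈ U) (I : Finset S) :
    ν {z | ∃ s ∈ I, LInf.section z s ∈ U} ≤ 2 * ν {z | LInf.section z m ∈ U} := by
  have hmeas (s : S) : MeasurableSet {z : LInf (S × T) | LInf.section z s ∈ U} :=
    (hU.preimage (LInf.continuous_section s)).measurableSet
  -- The event that `s` is the first time in `I` at which the path is in `U`.
  let B (s : S) : Set (LInf (S × T)) :=
    {z | LInf.section z s ∈ U ∧ ∀ r ∈ I, r < s → LInf.section z r ∉ U}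
  have hB (s : S) : MeasurableSet (B s) := by
    have : B s = {z | LInf.section z s ∈ U} ∩
        ⋂ r ∈ I, ⋂ _ : r < s, {z | LInf.section z r ∈ U}ᶜ := by
      ext z; simp [B]
    rw [this]
    exact (hmeas s).inter <| Finset.measurableSet_biInter _ fun r _ =>
      .iInter fun _ => (hmeas r).compl
  have hdisj : Set.PairwiseDisjoint (I : Set S) B := by
    intro r hr s hs hrs
    refine Set.disjoint_left.2 fun z hzr hzs => ?_
    rcases lt_or_gt_of_ne hrs with h | h
    · exact hzs.2 r hr h hzr.1
    · exact hzr.2 s hs h hzs.1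
  have hcover : {z | ∃ s ∈ I, LInf.section z s ∈ U} ⊆ ⋃ s ∈ I, B s := by
    classical
    rintro z ⟨s, hs, hsU⟩
    have hne : (I.filter fun r => LInf.section z r ∈ U).Nonempty := ⟨s, by simp [hs, hsU]⟩
    obtain ⟨r, hr, hmin⟩ := Finset.exists_min_image _ id hne
    rw [Finset.mem_filter] at hr
    refine Set.mem_biUnion hr.1 ⟨hr.2, fun q hq hqr hqU => ?_⟩
    exact absurd (hmin q (by simp [hq, hqU])) (not_le.2 hqr)
  -- `B s` depends only on the path up to `s`, which the reflection leaves unchanged.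
  have hrefl (s : S) : ν (B s ∩ {z | LInf.section (LInf.reflect s z) m ∈ U}) =
      ν (B s ∩ {z | LInf.section z m ∈ U}) := by
    conv_rhs => rw [← hν s]
    rw [Measure.map_apply (LInf.continuous_reflect s).measurable ((hB s).inter (hmeas m))]
    congr 1
    ext z
    simp only [Set.mem_inter_iff, Set.mem_preimage, Set.mem_ofPred_eq, B,
      LInf.section_reflect_of_le z le_rfl]
    refine and_congr_left fun _ => and_congr_right fun _ => forall₂_congr fun r _ =>
      forall_congr' fun hrs => ?_
    rw [LInf.section_reflect_of_le z hrs.le]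
  have hBle (s : S) : ν (B s) ≤ 2 * ν (B s ∩ {z | LInf.section z m ∈ U}) := by
    calc ν (B s) ≤ ν (B s ∩ {z | LInf.section z m ∈ U} ∪
          B s ∩ {z | LInf.section (LInf.reflect s z) m ∈ U}) := by
          refine measure_mono_ae ?_
          filter_upwards [hm s] with z hz hzB
          exact (hz hzB.1).imp (fun h => ⟨hzB, h⟩) fun h => ⟨hzB, h⟩
      _ ≤ _ := by
          refine (measure_union_le _ _).trans ?_
          rw [hrefl, two_mul]
  calc ν {z | ∃ s ∈ I, LInf.section z s ∈ U} ≤ ν (⋃ s ∈ I, B s) := measure_mono hcover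
    _ ≤ ∑ s ∈ I, ν (B s) := measure_biUnion_finset_le _ _
    _ ≤ ∑ s ∈ I, 2 * ν (B s ∩ {z | LInf.section z m ∈ U}) := Finset.sum_le_sum fun s _ => hBle s
    _ = 2 * ν (⋃ s ∈ I, B s ∩ {z | LInf.section z m ∈ U}) := by
        rw [← Finset.mul_sum, measure_biUnion_finset
          (hdisj.mono fun s => Set.inter_subset_left) fun s _ => (hB s).inter (hmeas m)]
    _ ≤ _ := by
        gcongr
        exact Set.iUnion₂_subset fun s _ => Set.inter_subset_right

end Reflect

/-! ### Norm exceedance and the Kiefer-Müller process. -/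

/-- Nonnegativity of `lam` matters when `T` is empty, where the supremum is `0`. -/
theorem lt_supNorm_iff {T : Type*} {x : T → ℝ} {lam : ℝ} (hlam : 0 ≤ lam) :
    (lam : EReal) < (supNorm x : EReal) ↔ ∃ t, lam < |x t| := by
  have h : (lam : EReal) = (ENNReal.ofReal lam : EReal) := by
    rw [EReal.coe_ennreal_ofReal, max_eq_left hlam]
  rw [h, EReal.coe_ennreal_lt_coe_ennreal_iff, supNorm, lt_iSup_iff]
  refine exists_congr fun t => ?_
  rw [Real.enorm_eq_ofReal_abs, ENNReal.ofReal_lt_ofReal_iff_of_nonneg hlam]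

theorem LInf.lt_norm_iff {T : Type*} {x : LInf T} {lam : ℝ} (hlam : 0 ≤ lam) :
    lam < ‖x‖ ↔ ∃ t, lam < |x t| := by
  refine ⟨fun h => ?_, fun ⟨t, ht⟩ => ht.trans_le (LInf.abs_apply_le_norm x t)⟩
  by_contra! h'
  exact absurd (LInf.norm_le hlam h') (not_le.2 h)

section KieferMuller

variable {𝒳 Ω : Type*} [MeasurableSpace 𝒳] [MeasurableSpace Ω] {P : Measure 𝒳}
  {F : Set (𝒳 → ℝ)} {μ : Measure Ω} {Z : Ω → LInf (Set.Ioc (0 : ℝ) 1 × F)}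

theorem IsKieferMuller.map_reflect (hZ : IsKieferMuller P F μ Z) (s : Set.Ioc (0 : ℝ) 1) :
    (μ.map Z).map (LInf.reflect s) = μ.map Z := by
  rw [AEMeasurable.map_map_of_aemeasurable (LInf.continuous_reflect s).aemeasurable
    hZ.aestronglyMeasurable.aemeasurable]
  exact (IsTightCenteredGaussian.reflect (a := Subtype.val) (Subtype.mono_coe _)
    (κ := fun f g : F => ∫ x, f.1 x * g.1 x ∂P - (∫ x, f.1 x ∂P) * ∫ x, g.1 x ∂P) hZ s).map_eq hZ

/-- The Kiefer-Müller process at time one is a Brownian bridge. -/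
theorem IsKieferMuller.isBrownianBridge_section (hZ : IsKieferMuller P F μ Z) :
    IsBrownianBridge P F μ fun ω => LInf.section (Z ω) ⟨1, by norm_num⟩ where
  aestronglyMeasurable :=
    (LInf.continuous_section _).comp_aestronglyMeasurable hZ.aestronglyMeasurable
  isGaussianProcess := hZ.isGaussianProcess.comp_right fun f : F => (⟨1, by norm_num⟩, f)
  mean_zero f := hZ.mean_zero (_, f)
  covariance_eq f g := by
    refine (hZ.covariance_eq (⟨1, by norm_num⟩, f) (⟨1, by norm_num⟩, g)).trans ?_
    simp

/-- A variance bound uniform over `F` makes the `L²`-semimetric between `(r, f)` and `(s, f)` small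
uniformly in `f` when `r` is close to `s`. -/
theorem integral_sq_sub_sq_integral_le_of_abs_sub_le [IsProbabilityMeasure P] {f : 𝒳 → ℝ}
    (hf : MemLp f 2 P) {C : ℝ} (hC : ∀ x, |f x - ∫ y, f y ∂P| ≤ C) :
    ∫ x, f x * f x ∂P - (∫ x, f x ∂P) * ∫ x, f x ∂P ≤ C ^ 2 := by
  have h := variance_eq_sub hf
  have h' := variance_eq_integral hf.aemeasurable
  have hle : ∫ x, (f x - ∫ y, f y ∂P) ^ 2 ∂P ≤ ∫ _, C ^ 2 ∂P :=
    integral_mono_of_nonneg (.of_forall fun _ => sq_nonneg _) (integrable_const _)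
      (.of_forall fun x => sq_le_sq' (abs_le.1 (hC x)).1 (abs_le.1 (hC x)).2)
  rw [integral_const, probReal_univ, one_smul] at hle
  simp only [Pi.pow_apply] at h
  simp_rw [← pow_two]
  linarith

/-- For a uniformly bounded class almost every path `s ↦ Z_s ∈ ℓ^∞(F)` of a Kiefer-Müller process
is continuous. -/
theorem IsKieferMuller.ae_continuous_section [IsProbabilityMeasure P]
    (hZ : IsKieferMuller P F μ Z) (hF_sq : ∀ f ∈ F, MemLp f 2 P)
    (hF_bdd : ∃ C : ℝ, ∀ x, ∀ f ∈ F, |f x - ∫ y, f y ∂P| ≤ C) :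
    ∀ᵐ ω ∂μ, Continuous fun s => LInf.section (Z ω) s := by
  obtain ⟨C, hC⟩ := hF_bdd
  filter_upwards [hZ.ae_uniformly_continuous] with ω hω
  refine Metric.continuous_iff.2 fun s ε hε => ?_
  obtain ⟨δ, hδ, h⟩ := hω (ε / 2) (half_pos hε)
  -- The squared semimetric is `|r - s|` times the variance of `f`, at most `|r - s| * C ^ 2`; the
  -- `+ 1` avoids division by zero.
  refine ⟨δ / (C ^ 2 + 1), by positivity, fun r hr => ?_⟩
  rw [dist_eq_norm]
  refine (LInf.norm_le (half_pos hε).le fun f => ?_).trans_lt (half_lt_self hε)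
  refine h (r, f) (s, f) ?_
  have hV := integral_sq_sub_sq_integral_le_of_abs_sub_le (hF_sq f f.2) fun x => hC x f f.2
  dsimp only
  set V := ∫ x, f.1 x * f.1 x ∂P - (∫ x, f.1 x ∂P) * ∫ x, f.1 x ∂P
  rw [Subtype.dist_eq, Real.dist_eq, lt_div_iff₀ (by positivity)] at hr
  have hmin : (r : ℝ) + s - 2 * min (r : ℝ) s = |(r : ℝ) - s| := by
    rcases le_total (r : ℝ) s with h | h
    · rw [min_eq_left h, abs_of_nonpos (by linarith)]; ring
    · rw [min_eq_right h, abs_of_nonneg (by linarith)]; ring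
  calc min (r : ℝ) r * V - 2 * (min (r : ℝ) s * V) + min (s : ℝ) s * V
      = |(r : ℝ) - s| * V := by rw [← hmin, min_self, min_self]; ring
    _ ≤ |(r : ℝ) - s| * (C ^ 2 + 1) := by gcongr; linarith
    _ < δ := hr

end KieferMuller

/-! ### The maximal inequality. -/

theorem mainTheorem6
    {𝒳 Ω₀ Ω Ω' ℰ : Type*} [MetricSpace 𝒳] [MeasurableSpace 𝒳] [BorelSpace 𝒳]
    [MeasurableSpace Ω₀] [MeasurableSpace Ω] [MeasurableSpace Ω']
    -- the i.i.d. observations with law `P`, and the class `F`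
    (P : Measure 𝒳) [IsProbabilityMeasure P]
    (μ₀ : Measure Ω₀) [IsProbabilityMeasure μ₀] (X : ℕ → Ω₀ → 𝒳)
    (hX_meas : ∀ i, Measurable (X i)) (hX_indep : iIndepFun X μ₀)
    (hX_law : ∀ i, μ₀.map (X i) = P)
    (F : Set (𝒳 → ℝ)) (hF_meas : ∀ f ∈ F, Measurable f) (hF_sq : ∀ f ∈ F, MemLp f 2 P)
    -- `F` is Donsker and bounded with respect to `P`
    (hF_donsker : IsDonsker P μ₀ X F)
    (hF_bdd : ∃ C : ℝ, ∀ x, ∀ f ∈ F, |f x - ∫ y, f y ∂P| ≤ C)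
    -- `φ` is Hadamard differentiable at `P ∈ ℓ^∞(F)` tangentially to `D0`
    (PF : LInf F) (hPF : ∀ f : F, PF f = ∫ x, f.1 x ∂P)
    (φ : LInf F → LInf ℰ) (Dφ D0 : Set (LInf F)) (dφ : LInf F → LInf ℰ)
    (hφ : HasHadamardDifferential φ Dφ PF D0 dφ)
    -- a Kiefer-Müller process `Z` whose law is concentrated on paths in `D0`
    (μ : Measure Ω) [IsProbabilityMeasure μ] (Z : Ω → LInf (Set.Ioc (0 : ℝ) 1 × F))
    (hZ : IsKieferMuller P F μ Z) (hZ_D0 : ∀ᵐ z ∂(μ.map Z), ∀ s, LInf.section z s ∈ D0)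
    -- a Brownian bridge `G`
    (μ' : Measure Ω') [IsProbabilityMeasure μ'] (G : Ω' → LInf F)
    (hG : IsBrownianBridge P F μ' G) (lam : ℝ) :
    μ {ω | (lam : EReal) <
        ((supNorm fun p : Set.Ioc (0 : ℝ) 1 × ℰ => dφ (LInf.section (Z ω) p.1) p.2 : ℝ≥0∞) : EReal)}
      ≤ 2 * μ' {ω | (lam : EReal) < ((supNorm fun e : ℰ => dφ (G ω) e : ℝ≥0∞) : EReal)} := by
  classical
  rcases lt_or_ge lam 0 with hlam | hlam
  · have huniv : {ω | (lam : EReal) < ((supNorm fun e : ℰ => dφ (G ω) e : ℝ≥0∞) : EReal)} =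
        Set.univ := Set.eq_univ_of_forall fun ω =>
      (EReal.coe_lt_coe_iff.2 hlam).trans_le (EReal.coe_ennreal_nonneg _)
    rw [huniv, measure_univ, mul_one]
    exact prob_le_one.trans one_le_two
  -- Continuity on `D0` only makes the exceedance set relatively open, so it is replaced by an open
  -- `U` with the same trace on `D0`.
  obtain ⟨U, hU, hUD⟩ := continuousOn_iff'.1 hφ.continuousOn {y | lam < ‖y‖}
    (isOpen_lt continuous_const continuous_norm)
  have hUD (x : LInf F) (hx : x ∈ D0) : x ∈ U ↔ lam < ‖dφ x‖ := by
    have := Set.ext_iff.1 hUD x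
    simp only [Set.mem_inter_iff, hx, and_true, Set.mem_preimage, Set.mem_ofPred_eq] at this
    exact this.symm
  have hZm := hZ.aestronglyMeasurable.aemeasurable
  have hGm := hG.aestronglyMeasurable.aemeasurable
  let one : Set.Ioc (0 : ℝ) 1 := ⟨1, by norm_num⟩
  have : Nonempty (Set.Ioc (0 : ℝ) 1) := ⟨one⟩
  have hmeas (s : Set.Ioc (0 : ℝ) 1) : MeasurableSet {z : LInf (_ × F) | LInf.section z s ∈ U} :=
    (hU.preimage (LInf.continuous_section s)).measurableSet
  -- the maximal inequality for finitely many times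
  have hlevy := LInf.measure_exists_section_mem_le (hZ.map_reflect) hU one fun s => by
    -- Linearity of `dφ` may be used only if `2 z_s - z_1` lies in `D0`; this holds almost surely
    -- because the reflected path has the same law.
    have hrefl : ∀ᵐ z ∂(μ.map Z), ∀ r, LInf.section (LInf.reflect s z) r ∈ D0 := by
      have h := hZ_D0
      rw [← hZ.map_reflect s] at h
      exact ae_of_ae_map (LInf.continuous_reflect s).aemeasurable h
    filter_upwards [hZ_D0, hrefl] with z hz hz' hzs
    rw [hUD _ (hz s)] at hzs
    rw [hUD _ (hz one), hUD _ (hz' one)]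
    have hR := LInf.section_reflect_of_ge z (show s ≤ one from s.2.2)
    have hlin := hφ.linearOn _ (hz s) _ (hz one) 2 (-1) (hR ▸ hz' one)
    rw [hR, hlin]
    by_contra! h
    have h₁ : (2 : ℝ) • dφ (LInf.section z s) =
        ((2 : ℝ) • dφ (LInf.section z s) + (-1 : ℝ) • dφ (LInf.section z one)) +
          dφ (LInf.section z one) := by module
    have h₂ := norm_add_le ((2 : ℝ) • dφ (LInf.section z s) +
      (-1 : ℝ) • dφ (LInf.section z one)) (dφ (LInf.section z one))
    rw [← h₁, norm_smul, Real.norm_ofNat] at h₂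
    linarith [h.1, h.2]
  -- the law of the process at time one is that of the Brownian bridge
  have hlaw : (μ.map Z).map (fun z => LInf.section z one) = μ'.map G := by
    rw [AEMeasurable.map_map_of_aemeasurable (LInf.continuous_section one).aemeasurable hZm]
    exact IsTightCenteredGaussian.map_eq hZ.isBrownianBridge_section hG
  have hGD : ∀ᵐ ω ∂μ', G ω ∈ D0 := by
    obtain ⟨S, hS, hZS⟩ := hZ.aestronglyMeasurable.isSeparable_ae_range
    have hcl : ∀ᵐ z ∂(μ.map Z), z ∈ closure S :=
      (ae_map_iff hZm (p := (· ∈ closure S)) isClosed_closure.measurableSet).2 <|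
        hZS.mono fun ω h => subset_closure h
    have h := ae_map_mem_of_continuous hS.closure hcl (LInf.continuous_section one)
      (hZ_D0.mono fun z hz => hz one)
    rw [hlaw] at h
    exact ae_of_ae_map hGm h
  have hone : (μ.map Z) {z | LInf.section z one ∈ U} ≤
      μ' {ω | (lam : EReal) < ((supNorm fun e : ℰ => dφ (G ω) e : ℝ≥0∞) : EReal)} := by
    have h₁ : (μ.map Z) {z | LInf.section z one ∈ U} = μ' {ω | G ω ∈ U} := by
      have h := Measure.map_apply (μ := μ.map Z) (LInf.continuous_section one).measurable
        hU.measurableSet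
      rw [hlaw, Measure.map_apply_of_aemeasurable hGm hU.measurableSet] at h
      exact h.symm
    rw [h₁]
    -- The event for `dφ (G ω)` may be non-measurable; only monotonicity of the outer measure is
    -- needed.
    refine measure_mono_ae ?_
    filter_upwards [hGD] with ω hω hωU
    exact (lt_supNorm_iff hlam).2 ((LInf.lt_norm_iff hlam).1 ((hUD _ hω).1 hωU))
  -- by continuity of the paths countably many times suffice
  let d := TopologicalSpace.denseSeq (Set.Ioc (0 : ℝ) 1)
  let A (n : ℕ) : Set (LInf (Set.Ioc (0 : ℝ) 1 × F)) :=
    {z | ∃ s ∈ (Finset.range n).image d, LInf.section z s ∈ U}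
  have hA_mono : Monotone A := fun m n hmn z ⟨s, hs, hsU⟩ =>
    ⟨s, Finset.image_subset_image (Finset.range_mono hmn) hs, hsU⟩
  have hA_meas : MeasurableSet (⋃ n, A n) := by
    refine .iUnion fun n => ?_
    have : A n = ⋃ s ∈ (Finset.range n).image d, {z | LInf.section z s ∈ U} := by
      ext z; simp [A]
    rw [this]
    exact Finset.measurableSet_biUnion _ fun s _ => hmeas s
  calc μ {ω | (lam : EReal) < ((supNorm fun p : Set.Ioc (0 : ℝ) 1 × ℰ =>
        dφ (LInf.section (Z ω) p.1) p.2 : ℝ≥0∞) : EReal)}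
      ≤ μ (Z ⁻¹' ⋃ n, A n) := by
        refine measure_mono_ae ?_
        filter_upwards [hZ.ae_continuous_section hF_sq hF_bdd, ae_of_ae_map hZm hZ_D0]
          with ω hcont hD hω
        obtain ⟨⟨s, e⟩, hse⟩ := (lt_supNorm_iff hlam).1 hω
        have hs : LInf.section (Z ω) s ∈ U :=
          (hUD _ (hD s)).2 ((LInf.lt_norm_iff hlam).2 ⟨e, hse⟩)
        -- The times with `Z_s ∈ U` form a nonempty open set, which contains some `d n`; `A` needs
        -- index `n + 1`, since `Finset.range n` stops before `n`.
        obtain ⟨r, hrU, n, rfl⟩ :=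
          (TopologicalSpace.denseRange_denseSeq _).inter_open_nonempty _ (hU.preimage hcont) ⟨s, hs⟩
        exact Set.mem_iUnion.2 ⟨n + 1, d n,
          Finset.mem_image_of_mem d (Finset.self_mem_range_succ n), hrU⟩
    _ = ⨆ n, (μ.map Z) (A n) := by
        rw [← Measure.map_apply_of_aemeasurable hZm hA_meas, hA_mono.measure_iUnion]
    _ ≤ 2 * (μ.map Z) {z | LInf.section z one ∈ U} := iSup_le fun n => hlevy _
    _ ≤ _ := by gcongr
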